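/- Let $m,n,p,q\ge 1$ be integers, and let $K_{a,b}$ denote the complete bipartite graph with parts of sizes $a$ and $b$. Let $G=K_{m,n}\vee K_{p,q}$ be the join of $K_{m,n}$ and $K_{p,q}$, that is, the graph obtained from their disjoint union by adding all edges between a vertex of $K_{m,n}$ and a vertex of $K_{p,q}$. Then the number $\tau(G)$ of spanning trees of $G$ is $$\tau(G)=(m+n+p+q)^2\,(m+p+q)^{n-1}\,(n+p+q)^{m-1}\,(p+m+n)^{q-1}\,(q+m+n)^{p-1}.$$ -/

import Mathlib

namespace SimpleGraph

/-- The join `G ∨ H` of two graphs with disjoint vertex sets: its vertex set is the union (here the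
disjoint sum) of the two vertex sets, and its edges are those of `G`, those of `H`, and all pairs
consisting of one vertex of `G` and one vertex of `H`. -/
def graphJoin {V W : Type*} (G : SimpleGraph V) (H : SimpleGraph W) : SimpleGraph (V ⊕ W) :=
  (G ⊕g H) ⊔ completeBipartiteGraph V W

/-- The set of spanning trees of `G`: subgraphs of `G` on the whole vertex set which are trees. -/
def spanningTrees {V : Type*} (G : SimpleGraph V) : Set (SimpleGraph V) :=
  {T | T ≤ G ∧ T.IsTree}

/-- The complexity `τ(G)`: the number of spanning trees of the graph `G` on a finite vertex set. -/
noncomputable def numSpanningTrees {V : Type*} [Finite V] (G : SimpleGraph V) : ℕ :=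
  (spanningTrees G).ncard

end SimpleGraph

open Finset Matrix

/-! ### Spanning trees as parent functions. -/

namespace SimpleGraph

variable {V : Type*}

/-! The join is the complete four-partite graph with parts m, n, p, q. Let L be its Laplacian, J the
all-ones matrix and N = m + n + p + q. Then L + J is block diagonal with blocks aI + J, where k is
the part size and a = N - k; each has determinant a ^ (k - 1) * N. Since det (L + J) = N ^ 2 * τ
(`det_add_ones` with the matrix-tree theorem), dividing by N ^ 2 gives the formula. For the
matrix-tree theorem, the reduced Laplacian determinant is expanded by rows over all maps f : V → V;
a term is 1 if f is a parent function and 0 otherwise. -/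

/-- A parent function for `G` rooted at `r`: it fixes `r`, sends every other vertex to a neighbour,
and its iterates send every vertex to `r`. -/
structure IsParentFunction (G : SimpleGraph V) (r : V) (f : V → V) : Prop where
  map_root : f r = r
  adj : ∀ v, v ≠ r → G.Adj v (f v)
  reaches : ∀ v, ∃ k, f^[k] v = r

/-- The graph with edges `{v, f v}`. -/
def functionGraph (f : V → V) : SimpleGraph V := fromRel fun u v ↦ f u = v

theorem functionGraph_adj {f : V → V} {u v : V} :
    (functionGraph f).Adj u v ↔ u ≠ v ∧ (f u = v ∨ f v = u) := by
  simp [functionGraph, fromRel_adj]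

namespace IsParentFunction

variable {G : SimpleGraph V} {r : V} {f g : V → V}

theorem functionGraph_le (h : G.IsParentFunction r f) : functionGraph f ≤ G := by
  have aux : ∀ u v, u ≠ v → f u = v → G.Adj u v := by
    rintro u v huv rfl
    refine h.adj u fun hu ↦ huv ?_
    rw [hu, h.map_root]
  intro u v huv
  obtain ⟨hne, h1 | h1⟩ := functionGraph_adj.1 huv
  · exact aux u v hne h1
  · exact (aux v u hne.symm h1).symm

theorem functionGraph_connected (h : G.IsParentFunction r f) : (functionGraph f).Connected := by
  have key : ∀ k v, f^[k] v = r → (functionGraph f).Reachable v r := by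
    intro k
    induction k with
    | zero => rintro v rfl; exact Reachable.refl _
    | succ k ih =>
      intro v hv
      by_cases hf : v = f v
      · rw [hf]; exact ih _ hv
      · exact (functionGraph_adj.2 ⟨hf, Or.inl rfl⟩ : (functionGraph f).Adj v (f v)).reachable.trans
          (ih _ hv)
  have key' : ∀ v, (functionGraph f).Reachable v r := fun v ↦
    let ⟨k, hk⟩ := h.reaches v; key k v hk
  have : Nonempty V := ⟨r⟩
  exact ⟨fun u v ↦ (key' u).trans (key' v).symm⟩

theorem functionGraph_isTree [Finite V] (h : G.IsParentFunction r f) :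
    (functionGraph f).IsTree := by
  refine isTree_iff_connected_and_card.2 ⟨h.functionGraph_connected, le_antisymm ?_
    h.functionGraph_connected.card_vert_le_card_edgeSet_add_one⟩
  have hsub : (functionGraph f).edgeSet ⊆ (fun v ↦ s(v, f v)) '' {r}ᶜ := by
    intro e
    induction e with
    | _ u v =>
      rw [mem_edgeSet, functionGraph_adj]
      rintro ⟨hne, rfl | rfl⟩
      · exact ⟨u, fun hu ↦ hne (by rw [Set.mem_singleton_iff.1 hu, h.map_root]), rfl⟩
      · exact ⟨v, fun hv ↦ hne (by rw [Set.mem_singleton_iff.1 hv, h.map_root]), Sym2.eq_swap⟩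
  have h1 := (Set.ncard_le_ncard hsub).trans (Set.ncard_image_le (Set.toFinite _))
  have h2 := Set.ncard_add_ncard_compl ({r} : Set V)
  rw [Set.ncard_singleton] at h2
  rw [Nat.card_coe_set_eq]
  omega

/-- A disagreement at `v` forces `g (f v) = v`, and hence one at `f v`, as a 2-cycle of `f` would
miss the root. It thus spreads along the orbit to `r`, where both maps agree. -/
theorem eq_of_functionGraph_eq (hf : G.IsParentFunction r f) (hg : G.IsParentFunction r g)
    (h : functionGraph f = functionGraph g) : f = g := by
  have step : ∀ v, f v ≠ g v → f (f v) ≠ g (f v) := by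
    intro v hv
    have hvr : v ≠ r := fun e ↦ hv (by rw [e, hf.map_root, hg.map_root])
    have hadj : (functionGraph g).Adj v (f v) :=
      h ▸ functionGraph_adj.2 ⟨(hf.adj v hvr).ne, Or.inl rfl⟩
    have hgv : g (f v) = v := ((functionGraph_adj.1 hadj).2).resolve_left fun e ↦ hv e.symm
    rw [hgv]
    intro hcyc
    have hfr : f v ≠ r := fun e ↦ hvr (by rw [← hgv, e, hg.map_root])
    have : ∀ k, f^[k] v ≠ r ∧ f^[k] (f v) ≠ r := by
      intro k
      induction k with
      | zero => exact ⟨hvr, hfr⟩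
      | succ k ih =>
        simp only [Function.iterate_succ, Function.comp_apply, hcyc]
        exact ih.symm
    obtain ⟨k, hk⟩ := hf.reaches v
    exact (this k).1 hk
  funext v
  by_contra hv
  have : ∀ k, f (f^[k] v) ≠ g (f^[k] v) := by
    intro k
    induction k with
    | zero => exact hv
    | succ k ih => rw [Function.iterate_succ_apply']; exact step _ ih
  obtain ⟨k, hk⟩ := hf.reaches v
  exact this k (by rw [hk, hf.map_root, hg.map_root])

end IsParentFunction

theorem Connected.exists_isParentFunction {G : SimpleGraph V} (h : G.Connected) (r : V) :
    ∃ f, G.IsParentFunction r f := by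
  have key : ∀ v, ∃ u, (v = r → u = r) ∧ (v ≠ r → G.Adj v u ∧ G.dist u r < G.dist v r) := by
    intro v
    by_cases hv : v = r
    · exact ⟨r, fun _ ↦ rfl, fun h ↦ absurd hv h⟩
    · obtain ⟨w, hw⟩ := h.exists_walk_length_eq_dist v r
      cases w with
      | nil => exact absurd rfl hv
      | cons hadj p =>
        refine ⟨_, fun h ↦ absurd h hv, fun _ ↦ ⟨hadj, ?_⟩⟩
        have := dist_le p
        rw [Walk.length_cons] at hw
        omega
  choose f hf hf' using key
  refine ⟨f, hf r rfl, fun v hv ↦ (hf' v hv).1, ?_⟩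
  have : ∀ n v, G.dist v r ≤ n → ∃ k, f^[k] v = r := by
    intro n
    induction n with
    | zero => exact fun v hv ↦ ⟨0, h.dist_eq_zero_iff.1 (Nat.le_zero.1 hv)⟩
    | succ n ih =>
      intro v hv
      by_cases hvr : v = r
      · exact ⟨0, hvr⟩
      · obtain ⟨k, hk⟩ := ih (f v) (by have := (hf' v hvr).2; omega)
        exact ⟨k + 1, hk⟩
  exact fun v ↦ this _ v le_rfl

/-- Spanning trees are counted by parent functions with a fixed root. -/
theorem numSpanningTrees_eq_ncard_isParentFunction [Finite V] (G : SimpleGraph V) (r : V) :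
    G.numSpanningTrees = {f | G.IsParentFunction r f}.ncard := by
  symm
  refine Set.ncard_congr (fun f _ ↦ functionGraph f) ?_ ?_ ?_
  · exact fun f hf ↦ ⟨hf.functionGraph_le, hf.functionGraph_isTree⟩
  · exact fun f g hf hg h ↦ hf.eq_of_functionGraph_eq hg h
  · rintro T ⟨hT, htree⟩
    obtain ⟨f, hf⟩ := htree.connected.exists_isParentFunction r
    refine ⟨f, ⟨hf.map_root, fun v hv ↦ hT (hf.adj v hv), hf.reaches⟩, ?_⟩
    exact le_antisymm hf.functionGraph_le
      ((isTree_iff_minimal_connected.1 htree).2 hf.functionGraph_connected hf.functionGraph_le)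

end SimpleGraph


/-! ### Determinant identities. -/

namespace Matrix

variable {n R : Type*} [Fintype n] [DecidableEq n]

theorem det_one_sub_of_isNilpotent [CommRing R] [IsDomain R] {F : Matrix n n R}
    (hF : IsNilpotent F) : (1 - F).det = 1 := by
  have h := (isNilpotent_charpoly_sub_pow_of_isNilpotent hF).eq_zero
  have h' := eval_charpoly F 1
  rw [sub_eq_zero.1 h] at h'
  simpa using h'.symm

theorem det_smul_one_add_ones [Field R] {a : R} (ha : a ≠ 0) :
    (a • (1 : Matrix n n R) + of fun _ _ ↦ 1).det
      = a ^ Fintype.card n * (1 + Fintype.card n / a) := by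
  have hJ : (of fun _ _ ↦ 1 : Matrix n n R)
      = replicateCol Unit (fun _ ↦ (1 : R)) * replicateRow Unit (fun _ ↦ (1 : R)) := by
    ext; simp [mul_apply]
  have hdet : (a • (1 : Matrix n n R)).det = a ^ Fintype.card n := by simp
  have hu : IsUnit (a • (1 : Matrix n n R)).det := by
    rw [hdet]; exact (pow_ne_zero _ ha).isUnit
  have hinv : (a • (1 : Matrix n n R))⁻¹ = a⁻¹ • 1 :=
    inv_eq_left_inv (by simp [smul_smul, mul_inv_cancel₀ ha])
  rw [hJ, det_add_replicateCol_mul_replicateRow hu, hdet, hinv]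
  simp [mul_apply, div_eq_mul_inv, mul_comm]

/-- If all rows and columns of `L` sum to zero, adding the all-ones matrix turns the determinant into
`n ^ 2` times any principal cofactor. -/
theorem det_add_ones [CommRing R] (L : Matrix n n R) (hrow : ∀ i, ∑ j, L i j = 0)
    (hcol : ∀ j, ∑ i, L i j = 0) (r : n) :
    (L + of fun _ _ ↦ 1).det = (Fintype.card n : R) ^ 2 * L.adjugate r r := by
  have h1 : (L + of fun _ _ ↦ 1).det
      = (Fintype.card n : R) * ((L + of fun _ _ ↦ 1).updateRow r fun _ ↦ 1).det := by
    have h := det_updateRow_sum (L + of fun _ _ ↦ 1) r fun _ ↦ 1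
    rw [one_smul] at h
    rw [← h, ← det_updateRow_smul]
    congr 2
    ext j
    rw [Finset.sum_apply]
    simp [sum_add_distrib, hcol]
  -- Row `r` is now all ones; subtracting it from the other rows removes the all-ones matrix.
  have h2 : ((L + of fun _ _ ↦ 1).updateRow r fun _ ↦ 1).det = (L.updateRow r fun _ ↦ 1).det := by
    refine det_eq_of_forall_row_eq_smul_add_const (fun i ↦ if i = r then 0 else 1) r (by simp) ?_
    intro i j
    by_cases hi : i = r
    · subst hi; simp
    · simp [hi]
  have h3 : (L.updateRow r fun _ ↦ 1).det
      = (Fintype.card n : R) * ((L.updateRow r fun _ ↦ 1).updateCol r (Pi.single r 1)).det := by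
    have h := det_updateCol_sum (L.updateRow r fun _ ↦ 1) r fun _ ↦ 1
    rw [one_smul] at h
    rw [← h, ← det_updateCol_smul]
    congr 2
    ext i
    by_cases hi : i = r
    · subst hi; simp
    · simp [hi, hrow]
  -- With column `r` a unit vector, the other entries of row `r` do not matter.
  have h4 : ((L.updateRow r fun _ ↦ 1).updateCol r (Pi.single r 1)).det = L.adjugate r r := by
    rw [← det_transpose, ← updateRow_transpose, ← adjugate_apply, ← adjugate_transpose,
      transpose_apply, adjugate_apply, adjugate_apply]
    congr 1
    ext i j
    by_cases hi : i = r
    · subst hi; simp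
    · simp [updateRow_ne hi]
  rw [h1, h2, h3, h4]
  ring

end Matrix

/-! ### The matrix-tree theorem. -/

namespace SimpleGraph

variable {V : Type*} [Fintype V] [DecidableEq V]

/-- The row at `v` of the matrix attached to choosing `u` as the image of `v`. -/
def parentRow (G : SimpleGraph V) [DecidableRel G.Adj] (r v u : V) : V → ℚ :=
  if v = r then (if u = r then Pi.single r 1 else 0)
  else if G.Adj v u then Pi.single v 1 - Pi.single u 1 else 0

theorem sum_lapMatrix_row (G : SimpleGraph V) [DecidableRel G.Adj] (i : V) :
    ∑ j, G.lapMatrix ℚ i j = 0 := by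
  have h := congrFun (G.lapMatrix_mulVec_const_eq_zero (R := ℚ)) i
  simpa [mulVec, dotProduct] using h

theorem sum_lapMatrix_col (G : SimpleGraph V) [DecidableRel G.Adj] (j : V) :
    ∑ i, G.lapMatrix ℚ i j = 0 := by
  rw [← G.sum_lapMatrix_row j]
  exact sum_congr rfl fun i _ ↦ (G.isSymm_lapMatrix (R := ℚ)).apply j i

theorem sum_parentRow (G : SimpleGraph V) [DecidableRel G.Adj] (r : V) :
    (fun v ↦ ∑ u, G.parentRow r v u) = (G.lapMatrix ℚ).updateRow r (Pi.single r 1) := by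
  ext v w
  by_cases hv : v = r
  · subst hv
    simp [parentRow, ite_apply]
  · rw [updateRow_ne hv]
    simp only [parentRow, hv, if_false, Finset.sum_apply, lapMatrix, degMatrix, Matrix.sub_apply,
      diagonal_apply, adjMatrix_apply, ite_apply, Pi.sub_apply, Pi.zero_apply, Pi.single_apply]
    rw [sum_congr rfl (g := fun u ↦ (if v = w then (if G.Adj v u then (1 : ℚ) else 0) else 0)
      - if w = u then (if G.Adj v w then (1 : ℚ) else 0) else 0)]
    · rw [sum_sub_distrib]
      by_cases h : v = w <;> simp [h, ← card_neighborFinset_eq_degree, neighborFinset_eq_filter]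
    · intro u _
      by_cases h1 : w = u
      · subst h1
        by_cases h2 : G.Adj v w
        · simp [h2, h2.ne, h2.ne']
        · simp [h2]
      · by_cases h2 : v = w
        · subst h2; by_cases h3 : G.Adj v u <;> simp [h1, h3]
        · by_cases h3 : G.Adj v u <;> simp [h1, h2, Ne.symm h2, h3]

theorem det_parentRow_of_isParentFunction {G : SimpleGraph V} [DecidableRel G.Adj] {r : V}
    {f : V → V} (h : G.IsParentFunction r f) :
    det (of fun v ↦ G.parentRow r v (f v)) = 1 := by
  let F : Matrix V V ℚ := of fun v ↦ if v = r then 0 else Pi.single (f v) 1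
  have hF : (of fun v ↦ G.parentRow r v (f v)) = 1 - F := by
    ext v w
    by_cases hv : v = r
    · subst hv
      simp [parentRow, F, h.map_root, one_apply, Pi.single_apply, eq_comm]
    · simp [parentRow, F, hv, h.adj v hv, one_apply, Pi.single_apply, eq_comm (a := w)]
  -- The extra power is needed because row `r` of `F`, not of `F ^ 0`, vanishes.
  have key : ∀ k v, f^[k] v = r → (F ^ (k + 1)) v = 0 := by
    intro k
    induction k with
    | zero =>
      rintro v rfl
      ext u
      simp [F]
    | succ k ih =>
      intro v hv
      ext u
      rw [pow_succ', mul_apply]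
      by_cases hvr : v = r
      · simp [F, hvr]
      · simp only [F, of_apply, hvr, if_false, Pi.single_apply, ite_mul, one_mul, zero_mul,
          sum_ite_eq', mem_univ, if_true]
        exact congrFun (ih _ hv) u
  rw [hF]
  apply det_one_sub_of_isNilpotent
  choose k hk using h.reaches
  have hstay : ∀ m, f^[m] r = r := fun m ↦ Function.iterate_fixed h.map_root m
  refine ⟨univ.sup k + 1, ?_⟩
  ext v u
  refine congrFun (key _ v ?_) u
  obtain ⟨d, hd⟩ := Nat.exists_eq_add_of_le (le_sup (f := k) (mem_univ v))
  rw [hd, add_comm, Function.iterate_add_apply, hk, hstay]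

/-- Either some row is zero, or the indicator of the vertices that never reach `r` lies in the
kernel. -/
theorem det_parentRow_of_not_isParentFunction {G : SimpleGraph V} [DecidableRel G.Adj] {r : V}
    {f : V → V} (h : ¬ G.IsParentFunction r f) :
    det (of fun v ↦ G.parentRow r v (f v)) = 0 := by
  classical
  by_cases hr : f r = r
  swap
  · exact det_eq_zero_of_row_eq_zero r fun j ↦ by simp [parentRow, hr]
  by_cases hadj : ∀ v, v ≠ r → G.Adj v (f v)
  swap
  · push Not at hadj
    obtain ⟨v, hv, hv'⟩ := hadj
    exact det_eq_zero_of_row_eq_zero v fun j ↦ by simp [parentRow, hv, hv']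
  have hreach : ∃ v, ∀ k, f^[k] v ≠ r := by
    by_contra! hc
    exact h ⟨hr, hadj, hc⟩
  obtain ⟨v, hv⟩ := hreach
  refine exists_mulVec_eq_zero_iff.1 ⟨fun w ↦ if ∃ k, f^[k] w = r then 0 else 1, ?_, ?_⟩
  · intro h0
    have := congrFun h0 v
    simp [hv] at this
  · ext w
    have hw : (∃ k, f^[k] w = r) ↔ ∃ k, f^[k] (f w) = r := by
      constructor
      · rintro ⟨k, hk⟩
        refine ⟨k, ?_⟩
        rw [← Function.iterate_succ_apply, Function.iterate_succ_apply', hk, hr]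
      · rintro ⟨k, hk⟩
        exact ⟨k + 1, hk⟩
    by_cases hwr : w = r
    · subst hwr
      have : ∃ k, f^[k] w = w := ⟨0, rfl⟩
      simp [mulVec, parentRow, hr, this]
    · have hsub : ∀ x : V → ℚ, (of fun v ↦ G.parentRow r v (f v)) w ⬝ᵥ x = x w - x (f w) := by
        intro x
        have hrow : (of fun v ↦ G.parentRow r v (f v)) w
            = (Pi.single w 1 - Pi.single (f w) 1 : V → ℚ) := by
          ext u
          simp [parentRow, hwr, hadj w hwr]
        rw [hrow, sub_dotProduct, single_one_dotProduct, single_one_dotProduct]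
      simp only [mulVec, hsub, hw, sub_self, Pi.zero_apply]

/-- Kirchhoff's matrix-tree theorem. -/
theorem adjugate_lapMatrix_eq_numSpanningTrees (G : SimpleGraph V) [DecidableRel G.Adj] (r : V) :
    (G.lapMatrix ℚ).adjugate r r = G.numSpanningTrees := by
  classical
  rw [adjugate_apply, ← sum_parentRow]
  have h := (detRowAlternating (R := ℚ) (n := V)).toMultilinearMap.map_sum
    fun v u ↦ G.parentRow r v u
  refine h.trans ?_
  have h2 : ∀ f : V → V, (detRowAlternating (R := ℚ) (n := V)).toMultilinearMap
      (fun v ↦ G.parentRow r v (f v)) = if G.IsParentFunction r f then 1 else 0 := by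
    intro f
    split_ifs with hf
    · exact det_parentRow_of_isParentFunction hf
    · exact det_parentRow_of_not_isParentFunction hf
  rw [sum_congr rfl fun f _ ↦ h2 f, sum_boole, numSpanningTrees_eq_ncard_isParentFunction G r,
    Set.ncard_eq_toFinset_card']
  simp

theorem det_lapMatrix_add_ones (G : SimpleGraph V) [DecidableRel G.Adj] [Nonempty V] :
    (G.lapMatrix ℚ + of fun _ _ ↦ 1).det = (Fintype.card V : ℚ) ^ 2 * G.numSpanningTrees := by
  rw [det_add_ones _ G.sum_lapMatrix_row G.sum_lapMatrix_col (Classical.arbitrary V),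
    adjugate_lapMatrix_eq_numSpanningTrees]

end SimpleGraph

/-! ### The join as a complete four-partite graph. -/

namespace SimpleGraph

theorem graphJoin_adj {V W : Type*} {G : SimpleGraph V} {H : SimpleGraph W} {x y : V ⊕ W} :
    (graphJoin G H).Adj x y ↔ (G ⊕g H).Adj x y ∨ (completeBipartiteGraph V W).Adj x y :=
  Iff.rfl

theorem lapMatrix_add_ones_apply {V : Type*} [Fintype V] [DecidableEq V] (G : SimpleGraph V)
    [DecidableRel G.Adj] (i j : V) :
    (G.lapMatrix ℚ + Matrix.of fun _ _ ↦ 1 : Matrix V V ℚ) i j =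
      (if i = j then ∑ k, if G.Adj i k then 1 else 0 else 0) - (if G.Adj i j then 1 else 0) + 1 := by
  rw [← degree_eq_sum_if_adj]
  simp [lapMatrix, degMatrix, Matrix.diagonal_apply, adjMatrix_apply]

open Matrix in
theorem lapMatrix_graphJoin_completeBipartiteGraph_add_ones (m n p q : ℕ)
    [DecidableRel (graphJoin (completeBipartiteGraph (Fin m) (Fin n))
      (completeBipartiteGraph (Fin p) (Fin q))).Adj] :
    (graphJoin (completeBipartiteGraph (Fin m) (Fin n))
      (completeBipartiteGraph (Fin p) (Fin q))).lapMatrix ℚ + (of fun _ _ ↦ 1) =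
    fromBlocks
      (fromBlocks (((n : ℚ) + p + q) • 1 + of fun _ _ ↦ 1) 0 0
        (((m : ℚ) + p + q) • 1 + of fun _ _ ↦ 1)) 0 0
      (fromBlocks (((q : ℚ) + m + n) • 1 + of fun _ _ ↦ 1) 0 0
        (((p : ℚ) + m + n) • 1 + of fun _ _ ↦ 1)) := by
  ext ((i | i) | (i | i)) ((j | j) | (j | j)) <;>
    rw [lapMatrix_add_ones_apply, Fintype.sum_sum_type, Fintype.sum_sum_type,
      Fintype.sum_sum_type] <;>
    simp [graphJoin_adj, one_apply, add_assoc, add_comm, add_left_comm]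

end SimpleGraph

theorem corollary4p2 (m n p q : ℕ) (hm : 1 ≤ m) (hn : 1 ≤ n) (hp : 1 ≤ p) (hq : 1 ≤ q) :
    SimpleGraph.numSpanningTrees
        (SimpleGraph.graphJoin
          (completeBipartiteGraph (Fin m) (Fin n)) (completeBipartiteGraph (Fin p) (Fin q))) =
      (m + n + p + q) ^ 2 * (m + p + q) ^ (n - 1) * (n + p + q) ^ (m - 1) *
        (p + m + n) ^ (q - 1) * (q + m + n) ^ (p - 1) := by
  classical
  obtain ⟨m, rfl⟩ := Nat.exists_eq_add_of_le' hm
  obtain ⟨n, rfl⟩ := Nat.exists_eq_add_of_le' hn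
  obtain ⟨p, rfl⟩ := Nat.exists_eq_add_of_le' hp
  obtain ⟨q, rfl⟩ := Nat.exists_eq_add_of_le' hq
  have h := SimpleGraph.det_lapMatrix_add_ones (SimpleGraph.graphJoin
    (completeBipartiteGraph (Fin (m + 1)) (Fin (n + 1)))
    (completeBipartiteGraph (Fin (p + 1)) (Fin (q + 1))))
  rw [SimpleGraph.lapMatrix_graphJoin_completeBipartiteGraph_add_ones, Matrix.det_fromBlocks_zero₂₁,
    Matrix.det_fromBlocks_zero₂₁, Matrix.det_fromBlocks_zero₂₁,
    Matrix.det_smul_one_add_ones (by positivity), Matrix.det_smul_one_add_ones (by positivity),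
    Matrix.det_smul_one_add_ones (by positivity), Matrix.det_smul_one_add_ones (by positivity)] at h
  simp only [Fintype.card_sum, Fintype.card_fin] at h
  -- In each block `a + (k + 1)` is the total number of vertices.
  have key : ∀ (a : ℚ) (k : ℕ), 0 < a →
      a ^ (k + 1) * (1 + ((k + 1 : ℕ) : ℚ) / a) = a ^ k * (a + (k + 1 : ℕ)) := by
    intro a k ha
    field_simp
    ring
  rw [key _ _ (by positivity), key _ _ (by positivity), key _ _ (by positivity),
    key _ _ (by positivity)] at h
  simp only [Nat.add_sub_cancel]
  have hN : ((((m + 1 + (n + 1) + (p + 1 + (q + 1)) : ℕ)) : ℚ)) ^ 2 ≠ 0 := by positivity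
  rw [← Nat.cast_inj (R := ℚ)]
  refine mul_left_cancel₀ hN (h.symm.trans ?_)
  push_cast
  ring
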